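/- Let $\alpha(x)=\tfrac13(\sinh x+x)$, a bijection of $\mathbb R$, let $Q(x)=\tfrac32\operatorname{sech}^2(x/2)$, $\widetilde Q=Q\circ\alpha^{-1}$, and $V=2\widetilde Q^{2}(1-\widetilde Q)$. Consider $L=-\partial_x^2+V$ with domain $H^2(\mathbb R)$. Let $-\mu_0^2<0$ (with $\mu_0>0$) be the first (lowest) eigenvalue of $L$ and let $\phi_0>0$ be the associated positive eigenfunction with $\|\phi_0\|_{L^2}=1$. Put $$V_0=2\Big(\frac{\phi_0'}{\phi_0}\Big)^2-2\mu_0^2-V,\qquad L_0=-\partial_x^2+V_0 .$$ Then $V_0$ is differentiable, $V_0'$ is odd, and $V_0'(x)<0$ for all $x>0$. In particular, $L_0$ is repulsive, that is, $x\,V_0'(x)\le 0$ for every $x\in\mathbb R$. Moreover, $V_0'$ decays like $V'$: there are constants $0<c\le C$ and $R>0$ such that $c\,|V'(x)|\le |V_0'(x)|\le C\,|V'(x)|$ for $|x|\ge R$. More precisely, $V''$ has exactly two positive zeros $x_{2,1}<x_{2,2}$, and $$3V'(x)\le V_0'(x)\le \tfrac12 V'(x)\qquad\text{for all } x\ge x_{2,2}.$$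 -/

import Mathlib

open MeasureTheory Filter Asymptotics

namespace BizonKahl

noncomputable section

/-- The change of variables `α(x) = (sinh x + x) / 3`. -/
def alpha (x : ℝ) : ℝ := (Real.sinh x + x) / 3

theorem alpha_strictMono : StrictMono alpha := by
  intro a b h
  have := Real.sinh_strictMono h
  unfold alpha
  linarith

theorem alpha_bijective : Function.Bijective alpha := by
  refine ⟨alpha_strictMono.injective, ?_⟩
  have hc : Continuous alpha := by unfold alpha; fun_prop
  have hle : ∀ x : ℝ, 0 ≤ x → x / 3 ≤ alpha x := fun x hx => by
    have := Real.sinh_nonneg_iff.mpr hx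
    unfold alpha; linarith
  have hge : ∀ x : ℝ, x ≤ 0 → alpha x ≤ x / 3 := fun x hx => by
    have := Real.sinh_nonpos_iff.mpr hx
    unfold alpha; linarith
  refine hc.surjective ?_ ?_
  · refine tendsto_atTop_mono' _ ?_ (tendsto_id.atTop_div_const (by norm_num : (0 : ℝ) < 3))
    filter_upwards [eventually_ge_atTop (0 : ℝ)] with x hx using hle x hx
  · refine tendsto_atBot_mono' _ ?_ (tendsto_id.atBot_div_const (by norm_num : (0 : ℝ) < 3))
    filter_upwards [eventually_le_atBot (0 : ℝ)] with x hx using hge x hx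

/-- The inverse function `α⁻¹ : ℝ → ℝ`. -/
def alphaInv (x : ℝ) : ℝ := (Equiv.ofBijective alpha alpha_bijective).symm x

/-- The soliton `Q(x) = (3/2) sech²(x/2)`. -/
def Q (x : ℝ) : ℝ := 3 / 2 * (1 / Real.cosh (x / 2)) ^ 2

/-- The distorted soliton `Q ∘ α⁻¹`. -/
def Qtilde (x : ℝ) : ℝ := Q (alphaInv x)

/-- The potential `V = 2 Qtilde² (1 - Qtilde)`. -/
def V (x : ℝ) : ℝ := 2 * Qtilde x ^ 2 * (1 - Qtilde x)

/-- The Schrödinger operator `-∂ₓ² + W`. -/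
def schrodinger (W f : ℝ → ℝ) (x : ℝ) : ℝ := -deriv (deriv f) x + W x * f x

/-- The Sobolev space `H²(ℝ)` (real-valued, continuous representatives): `f` is `C¹`, `f'` is locally
absolutely continuous, and `f`, `f'`, `f''` are square integrable. For such `f` the function
`deriv (deriv f)` agrees almost everywhere with the weak second derivative. -/
structure MemH2 (f : ℝ → ℝ) : Prop where
  contDiff : ContDiff ℝ 1 f
  absCont : ∀ a b : ℝ, AbsolutelyContinuousOnInterval (deriv f) a b
  memLp : MemLp f 2 volume
  memLp_deriv : MemLp (deriv f) 2 volume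
  memLp_deriv_deriv : MemLp (deriv (deriv f)) 2 volume

/-- `f` is an eigenfunction of `-∂ₓ² + W`, with domain `H²(ℝ)`, for the eigenvalue `l`. -/
structure IsEigenfunction (W : ℝ → ℝ) (l : ℝ) (f : ℝ → ℝ) : Prop where
  memH2 : MemH2 f
  ne_zero : ∃ x, f x ≠ 0
  eigen : ∀ᵐ x : ℝ, schrodinger W f x = l * f x

/-- `-μ² < 0` (with `μ > 0`) is the first eigenvalue of `-∂ₓ² + W`, and `φ` is the positive
eigenfunction of unit `L²` norm associated with it. -/
structure IsGroundState (W : ℝ → ℝ) (μ : ℝ) (φ : ℝ → ℝ) : Prop where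
  mu_pos : 0 < μ
  isEigenfunction : IsEigenfunction W (-μ ^ 2) φ
  first : ∀ (l : ℝ) (f : ℝ → ℝ), IsEigenfunction W l f → -μ ^ 2 ≤ l
  pos : ∀ x, 0 < φ x
  unit_norm : ∫ x, φ x ^ 2 = 1

/-- The Darboux-transformed potential `V₀ = 2 (φ' / φ)² - 2 μ² - V`. -/
def V0 (μ : ℝ) (φ : ℝ → ℝ) (x : ℝ) : ℝ := 2 * (deriv φ x / φ x) ^ 2 - 2 * μ ^ 2 - V x

/-- The Schrödinger operator `-∂ₓ² + W` is repulsive: `x W'(x) ≤ 0` for every `x`. -/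
def IsRepulsive (W : ℝ → ℝ) : Prop := Differentiable ℝ W ∧ ∀ x : ℝ, x * deriv W x ≤ 0

end

end BizonKahl

open BizonKahl

namespace BizonKahl

/-! ### The variable `T = tanh (α⁻¹ / 2)` -/

/-! In the variable `T = tanh (α⁻¹ / 2)`, which satisfies `T' = (3/4)(1 - T²)²`, the potential and
its first two derivatives are polynomials, so pointwise estimates reduce to polynomial inequalities
in `T` or `s = T²`.

Put `σ = -φ₀'/φ₀` and `w = -σ`. The eigenvalue equation becomes the Riccati equation `σ' = σ² - V -
μ²`, and `V₀' = 4 w w' - V'`. Thus `V₀' < 0` means `w w' < V'/4`, and the tail bounds mean `V' ≤ w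
w' ≤ (3/8) V'`. The flux `(w w' - c V') φ₀²` tends to `0` at infinity and has derivative `φ₀² ((w')²
- (1 - 2c) σ V' - c V'')`. A sign of this derivative on `[a, ∞)` therefore decides the sign of the
flux at `a`. The choice `c = 1/4` works where `T² ≥ 1/4` (`flux_deriv_pos`); `c = 3/8` and `c = 1`
work in the tail (`flux_upper_deriv`, `flux_lower_deriv`). Where `T² ≤ 1/4`, a polynomial
supersolution of the Riccati equation bounds `σ` instead (`flux_neg_near_zero`).

The quantitative inputs are bounds on `σ` from monotone energies `φ₀'² - (K + θ V) φ₀²` that vanish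
at infinity (`sigma_sq_le`, `mu_le_sigma`, `le_sigma_sq`), and `16/25 ≤ μ² ≤ 7/10`, obtained by
playing barriers started at `0` against those bounds. -/

theorem alpha_alphaInv (y : ℝ) : alpha (alphaInv y) = y :=
  (Equiv.ofBijective alpha alpha_bijective).apply_symm_apply y

theorem alphaInv_alpha (x : ℝ) : alphaInv (alpha x) = x :=
  (Equiv.ofBijective alpha alpha_bijective).symm_apply_apply x

theorem alphaInv_strictMono : StrictMono alphaInv := fun a b h => by
  rw [← alpha_strictMono.lt_iff_lt, alpha_alphaInv, alpha_alphaInv]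
  exact h

theorem alpha_neg (x : ℝ) : alpha (-x) = -alpha x := by
  unfold alpha
  rw [Real.sinh_neg]
  ring

theorem alphaInv_neg (y : ℝ) : alphaInv (-y) = -alphaInv y := by
  apply alpha_strictMono.injective
  rw [alpha_neg, alpha_alphaInv, alpha_alphaInv]

theorem continuous_alphaInv : Continuous alphaInv :=
  alphaInv_strictMono.monotone.continuous_of_surjective fun x => ⟨alpha x, alphaInv_alpha x⟩

theorem hasDerivAt_alpha (x : ℝ) : HasDerivAt alpha ((Real.cosh x + 1) / 3) x :=
  ((Real.hasDerivAt_sinh x).add (hasDerivAt_id x)).div_const 3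

theorem hasDerivAt_alphaInv (y : ℝ) :
    HasDerivAt alphaInv ((Real.cosh (alphaInv y) + 1) / 3)⁻¹ y :=
  HasDerivAt.of_local_left_inverse continuous_alphaInv.continuousAt (hasDerivAt_alpha _)
    (by have := Real.cosh_pos (alphaInv y); positivity)
    (Eventually.of_forall alpha_alphaInv)

/-- The uniformizing variable in which `V` is a polynomial. -/
noncomputable def T (y : ℝ) : ℝ := Real.tanh (alphaInv y / 2)

theorem one_sub_tanh_sq (x : ℝ) : 1 - Real.tanh x ^ 2 = (1 / Real.cosh x) ^ 2 := by
  have := Real.cosh_pos x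
  have h := Real.cosh_sq x
  rw [Real.tanh_eq_sinh_div_cosh]
  field_simp
  linarith

theorem hasDerivAt_T (y : ℝ) : HasDerivAt T (3 / 4 * (1 - T y ^ 2) ^ 2) y := by
  have hc := Real.cosh_pos (alphaInv y / 2)
  have h2 : Real.cosh (alphaInv y) + 1 = 2 * Real.cosh (alphaInv y / 2) ^ 2 := by
    have h := Real.cosh_two_mul (alphaInv y / 2)
    rw [mul_div_cancel₀ _ (two_ne_zero)] at h
    rw [h, Real.sinh_sq]
    ring
  have ht : ∀ x, HasDerivAt Real.tanh ((1 / Real.cosh x) ^ 2) x := fun x => by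
    have hx := Real.cosh_pos x
    have h := (Real.hasDerivAt_sinh x).div (Real.hasDerivAt_cosh x) hx.ne'
    have e : Real.tanh = fun x => Real.sinh x / Real.cosh x :=
      funext Real.tanh_eq_sinh_div_cosh
    rw [e]
    refine h.congr_deriv ?_
    have := Real.cosh_sq x
    field_simp
    linarith
  refine ((ht _).comp y ((hasDerivAt_alphaInv y).div_const 2)).congr_deriv ?_
  unfold T
  rw [one_sub_tanh_sq, h2]
  field_simp
  norm_num

theorem T_neg (y : ℝ) : T (-y) = -T y := by
  unfold T
  rw [alphaInv_neg, neg_div, Real.tanh_neg]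

theorem T_zero : T 0 = 0 := by
  have := T_neg 0
  rw [neg_zero] at this
  linarith

theorem T_sq_lt_one (y : ℝ) : T y ^ 2 < 1 := by
  have h := one_sub_tanh_sq (alphaInv y / 2)
  have := Real.cosh_pos (alphaInv y / 2)
  have : 0 < (1 / Real.cosh (alphaInv y / 2)) ^ 2 := by positivity
  unfold T
  linarith

theorem T_lt_one (y : ℝ) : T y < 1 := by
  nlinarith [T_sq_lt_one y]

theorem T_strictMono : StrictMono T := by
  refine strictMono_of_deriv_pos fun y => ?_
  rw [(hasDerivAt_T y).deriv]
  have := sub_pos.2 (T_sq_lt_one y)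
  positivity

theorem T_pos {y : ℝ} (hy : 0 < y) : 0 < T y := T_zero ▸ T_strictMono hy

theorem T_nonneg {y : ℝ} (hy : 0 ≤ y) : 0 ≤ T y := T_zero ▸ T_strictMono.monotone hy

theorem exists_T_eq {t : ℝ} (h0 : 0 < t) (h1 : t < 1) : ∃ y, 0 < y ∧ T y = t := by
  have key : T (alpha (2 * Real.artanh t)) = t := by
    unfold T
    rw [alphaInv_alpha, mul_div_cancel_left₀ _ (two_ne_zero)]
    exact Real.tanh_artanh ⟨by linarith, h1⟩
  refine ⟨_, ?_, key⟩
  rw [← T_strictMono.lt_iff_lt, key, T_zero]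
  exact h0

/-! ### The potential and its derivatives -/

theorem V_eq (y : ℝ) : V y = 9 / 4 * (1 - T y ^ 2) ^ 2 * (3 * T y ^ 2 - 1) := by
  have h : Qtilde y = 3 / 2 * (1 - T y ^ 2) := by
    unfold Qtilde Q T
    rw [one_sub_tanh_sq]
  unfold V
  rw [h]
  ring

/-- The derivative of `V`. -/
noncomputable def DV (y : ℝ) : ℝ := 27 / 8 * T y * (1 - T y ^ 2) ^ 3 * (5 - 9 * T y ^ 2)

/-- The second derivative of `V`. -/
noncomputable def DDV (y : ℝ) : ℝ :=
  81 / 32 * (1 - T y ^ 2) ^ 4 * (81 * (T y ^ 2) ^ 2 - 62 * T y ^ 2 + 5)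

theorem hasDerivAt_V (y : ℝ) : HasDerivAt V (DV y) y := by
  have e : V = fun y => 9 / 4 * (1 - T y ^ 2) ^ 2 * (3 * T y ^ 2 - 1) := funext V_eq
  rw [e]
  have hT := hasDerivAt_T y
  have h := (((hT.fun_pow 2).const_sub 1).fun_pow 2 |>.const_mul (9 / 4)).fun_mul
    (((hT.fun_pow 2).const_mul 3).sub_const 1)
  refine h.congr_deriv ?_
  unfold DV
  push_cast
  ring

theorem hasDerivAt_DV (y : ℝ) : HasDerivAt DV (DDV y) y := by
  have hT := hasDerivAt_T y
  have h := ((hT.const_mul (27 / 8)).fun_mul (((hT.fun_pow 2).const_sub 1).fun_pow 3)).fun_mul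
    (((hT.fun_pow 2).const_mul 9).const_sub 5)
  refine h.congr_deriv ?_
  unfold DDV
  push_cast
  ring

theorem deriv_V : deriv V = DV := funext fun y => (hasDerivAt_V y).deriv

theorem deriv_DV : deriv DV = DDV := funext fun y => (hasDerivAt_DV y).deriv

theorem continuous_V : Continuous V :=
  continuous_iff_continuousAt.2 fun y => (hasDerivAt_V y).continuousAt

theorem V_neg (y : ℝ) : V (-y) = V y := by
  rw [V_eq, V_eq, T_neg]
  ring

theorem DV_neg (y : ℝ) : DV (-y) = -DV y := by
  unfold DV
  rw [T_neg]
  ring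

theorem V_nonneg {y : ℝ} (h : 1 / 3 ≤ T y ^ 2) : 0 ≤ V y := by
  rw [V_eq]
  have : 0 ≤ 3 * T y ^ 2 - 1 := by linarith
  positivity

theorem V_le (y : ℝ) : V y ≤ 8 / 27 := by
  rw [V_eq]

  -- This product is `108 (8/27 - V)`; the double root marks the maximum of `V`, at `T² = 5/9`.
  have : 0 ≤ (9 * T y ^ 2 - 5) ^ 2 * (11 - 9 * T y ^ 2) :=
    mul_nonneg (sq_nonneg _) (by linarith [T_sq_lt_one y])
  nlinarith

theorem V_le_V {x y : ℝ} (hx : 0 ≤ x) (hxy : x ≤ y) (hy : T y ^ 2 ≤ 1 / 3) : V x ≤ V y := by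
  have h0 := T_nonneg hx
  have h1 := T_strictMono.monotone hxy
  have hs : T x ^ 2 ≤ T y ^ 2 := pow_le_pow_left₀ h0 h1 2
  have h2 := sq_nonneg (T x)
  rw [V_eq, V_eq]
  generalize T x ^ 2 = a at *
  generalize T y ^ 2 = b at *
  nlinarith [mul_nonneg (sub_nonneg.2 hs) (mul_nonneg h2 (h2.trans hs)),
    mul_nonneg (sub_nonneg.2 hs) (sub_nonneg.2 hy), mul_nonneg (sub_nonneg.2 hs)
      (sub_nonneg.2 (hs.trans hy)), mul_nonneg (sub_nonneg.2 hs) (sq_nonneg a),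
      mul_nonneg (sub_nonneg.2 hs) (sq_nonneg b)]

theorem abs_DV_le (y : ℝ) : |DV y| ≤ 30 := by
  have h1 := T_sq_lt_one y
  have h0 := sq_nonneg (T y)
  have ha : |T y| ≤ 1 := (sq_le_one_iff_abs_le_one _).1 h1.le
  have hb : |5 - 9 * T y ^ 2| ≤ 5 := abs_le.2 ⟨by linarith, by linarith⟩
  have hc : |(1 - T y ^ 2) ^ 3| ≤ 1 := by
    rw [abs_of_nonneg (pow_nonneg (by linarith) 3)]
    exact pow_le_one₀ (by linarith) (by linarith)
  unfold DV
  rw [abs_mul, abs_mul, abs_mul, abs_of_pos (by norm_num : (0 : ℝ) < 27 / 8)]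
  calc 27 / 8 * |T y| * |(1 - T y ^ 2) ^ 3| * |5 - 9 * T y ^ 2| ≤ 27 / 8 * 1 * 1 * 5 := by gcongr
    _ ≤ 30 := by norm_num

/-! ### Monotonicity tools -/

theorem not_integrable_of_const_le {f : ℝ → ℝ} (hf : Integrable f) {c y₀ : ℝ} (hc : 0 < c)
    (h : ∀ y, y₀ ≤ y → c ≤ f y) : False := by
  have h1 : IntegrableOn (fun _ : ℝ => c) (Set.Ici y₀) := by
    refine Integrable.mono' hf.integrableOn aestronglyMeasurable_const ?_
    refine (ae_restrict_iff' measurableSet_Ici).2 (Eventually.of_forall fun y hy => ?_)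
    rw [Real.norm_of_nonneg hc.le]
    exact h y hy
  rw [integrableOn_const_iff] at h1
  rcases h1 with h1 | h1
  · exact hc.ne' (by simpa using h1)
  · simp at h1

theorem monotoneOn_Ici_of_hasDerivAt {F F' : ℝ → ℝ} {a : ℝ} (hF : ∀ y, HasDerivAt F (F' y) y)
    (h : ∀ y, a ≤ y → 0 ≤ F' y) : MonotoneOn F (Set.Ici a) := by
  refine monotoneOn_of_deriv_nonneg (convex_Ici a)
    (fun y _ => (hF y).continuousAt.continuousWithinAt)
    (fun y _ => (hF y).differentiableAt.differentiableWithinAt) fun y hy => ?_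
  rw [(hF y).deriv]
  rw [interior_Ici] at hy
  exact h y (Set.mem_Ioi.1 hy).le

theorem nonpos_of_tendsto_zero {F F' : ℝ → ℝ} {a : ℝ} (hF : ∀ y, HasDerivAt F (F' y) y)
    (h : ∀ y, a ≤ y → 0 ≤ F' y) (hlim : Tendsto F atTop (nhds 0)) : F a ≤ 0 := by
  have hm := monotoneOn_Ici_of_hasDerivAt hF h
  refine ge_of_tendsto hlim ?_
  filter_upwards [eventually_ge_atTop a] with y hy
  exact hm (Set.mem_Ici.2 le_rfl) hy hy

theorem nonneg_of_tendsto_zero {F F' : ℝ → ℝ} {a : ℝ} (hF : ∀ y, HasDerivAt F (F' y) y)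
    (h : ∀ y, a ≤ y → F' y ≤ 0) (hlim : Tendsto F atTop (nhds 0)) : 0 ≤ F a := by
  have := nonpos_of_tendsto_zero (F := fun y => -F y) (F' := fun y => -F' y) (a := a)
    (fun y => (hF y).fun_neg) (fun y hy => neg_nonneg.2 (h y hy)) (by simpa using hlim.neg)
  linarith

theorem neg_of_tendsto_zero {F F' : ℝ → ℝ} {a : ℝ} (hF : ∀ y, HasDerivAt F (F' y) y)
    (h : ∀ y, a ≤ y → 0 < F' y) (hlim : Tendsto F atTop (nhds 0)) : F a < 0 := by
  have hs : StrictMonoOn F (Set.Ici a) := by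
    refine strictMonoOn_of_deriv_pos (convex_Ici a)
      (fun y _ => (hF y).continuousAt.continuousWithinAt) fun y hy => ?_
    rw [(hF y).deriv]
    rw [interior_Ici] at hy
    exact h y (Set.mem_Ioi.1 hy).le
  have h1 : F a < F (a + 1) := hs (Set.mem_Ici.2 le_rfl) (Set.mem_Ici.2 (by linarith)) (by linarith)
  have h2 : F (a + 1) ≤ 0 :=
    nonpos_of_tendsto_zero hF (fun y hy => (h y (by linarith)).le) hlim
  linarith

/-- A Grönwall-type comparison principle. -/
theorem nonneg_of_deriv_ge_mul {u u' g : ℝ → ℝ} {b : ℝ} (hg : Continuous g)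
    (hu : ∀ y, HasDerivAt u (u' y) y) (h0 : 0 ≤ u 0)
    (h : ∀ y, 0 ≤ y → y ≤ b → g y * u y ≤ u' y) (hb : 0 ≤ b) : 0 ≤ u b := by
  have hG : ∀ y, HasDerivAt (fun y => ∫ x in (0 : ℝ)..y, g x) (g y) y := fun y =>
    intervalIntegral.integral_hasDerivAt_right (hg.intervalIntegrable _ _)
      hg.stronglyMeasurable.stronglyMeasurableAtFilter hg.continuousAt
  have hF : ∀ y, HasDerivAt (fun y => u y * Real.exp (-∫ x in (0 : ℝ)..y, g x))
      ((u' y - g y * u y) * Real.exp (-∫ x in (0 : ℝ)..y, g x)) y := fun y =>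
    ((hu y).fun_mul (hG y).fun_neg.exp).congr_deriv (by ring)
  have hm : MonotoneOn (fun y => u y * Real.exp (-∫ x in (0 : ℝ)..y, g x)) (Set.Icc 0 b) := by
    refine monotoneOn_of_deriv_nonneg (convex_Icc 0 b)
      (fun y _ => (hF y).continuousAt.continuousWithinAt)
      (fun y _ => (hF y).differentiableAt.differentiableWithinAt) fun y hy => ?_
    rw [(hF y).deriv]
    rw [interior_Icc] at hy
    have := h y hy.1.le hy.2.le
    exact mul_nonneg (by linarith) (Real.exp_pos _).le
  have h1 := hm (Set.left_mem_Icc.2 hb) (Set.right_mem_Icc.2 hb) hb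
  simp only [intervalIntegral.integral_same, neg_zero, Real.exp_zero, mul_one] at h1
  exact nonneg_of_mul_nonneg_left (h0.trans h1) (Real.exp_pos _)

/-! ### Positive solutions of the eigenvalue equation -/

/-- `φ` is a positive square integrable classical solution of `φ'' = (V + μ²) φ`, with derivative
`φ'`. -/
structure PosSol (μ : ℝ) (φ φ' : ℝ → ℝ) : Prop where
  mu_pos : 0 < μ
  pos : ∀ y, 0 < φ y
  deriv_one : ∀ y, HasDerivAt φ (φ' y) y
  deriv_two : ∀ y, HasDerivAt φ' ((V y + μ ^ 2) * φ y) y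
  integrable : Integrable fun y => φ y ^ 2

/-- The equation holds only almost everywhere, but absolute continuity makes `φ'` the integral of
the continuous function `(V + μ²) φ`, so it holds everywhere. -/
theorem IsGroundState.posSol {μ : ℝ} {φ : ℝ → ℝ} (h : IsGroundState V μ φ) :
    PosSol μ φ (deriv φ) := by
  have hH := h.isEigenfunction.memH2
  have hφc : Continuous φ := hH.contDiff.continuous
  have hc : Continuous fun y => (V y + μ ^ 2) * φ y :=
    (continuous_V.add continuous_const).mul hφc
  refine ⟨h.mu_pos, h.pos, fun y => (hH.contDiff.differentiable one_ne_zero y).hasDerivAt,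
    fun y => ?_, hH.memLp.integrable_sq⟩
  have hae : ∀ᵐ x : ℝ, deriv (deriv φ) x = (V x + μ ^ 2) * φ x := by
    filter_upwards [h.isEigenfunction.eigen] with x hx
    unfold schrodinger at hx
    linarith
  have hint : ∀ z, deriv φ z = deriv φ 0 + ∫ x in (0 : ℝ)..z, (V x + μ ^ 2) * φ x := fun z => by
    have h1 := (hH.absCont 0 z).integral_deriv_eq_sub
    rw [intervalIntegral.integral_congr_ae (hae.mono fun x hx _ => hx)] at h1
    linarith
  have hd : HasDerivAt (fun z => deriv φ 0 + ∫ x in (0 : ℝ)..z, (V x + μ ^ 2) * φ x)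
      ((V y + μ ^ 2) * φ y) y :=
    (intervalIntegral.integral_hasDerivAt_right (hc.intervalIntegrable _ _)
      hc.stronglyMeasurable.stronglyMeasurableAtFilter hc.continuousAt).const_add _
  rwa [← funext hint] at hd

namespace PosSol

variable {μ : ℝ} {φ φ' : ℝ → ℝ}

theorem reflect (h : PosSol μ φ φ') : PosSol μ (fun y => φ (-y)) (fun y => -φ' (-y)) where
  mu_pos := h.mu_pos
  pos y := h.pos (-y)
  deriv_one y := ((h.deriv_one (-y)).comp y (hasDerivAt_neg y)).congr_deriv (by ring)
  deriv_two y := ((h.deriv_two (-y)).comp y (hasDerivAt_neg y)).fun_neg.congr_deriv (by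
    rw [V_neg]; ring)
  integrable := h.integrable.comp_neg

/-- Were `φ' a > 0`, convexity would keep `φ` above `φ a` on `[a, ∞)`, against square integrability.
-/
theorem deriv_nonpos_of_convex (h : PosSol μ φ φ') {a : ℝ}
    (ha : ∀ y, a ≤ y → 0 ≤ V y + μ ^ 2) : φ' a ≤ 0 := by
  by_contra! hpos
  have hm := monotoneOn_Ici_of_hasDerivAt h.deriv_two
    (fun y hy => mul_nonneg (ha y hy) (h.pos y).le)
  have hm2 : MonotoneOn φ (Set.Ici a) := monotoneOn_Ici_of_hasDerivAt h.deriv_one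
    (fun y hy => hpos.le.trans (hm (Set.mem_Ici.2 le_rfl) hy hy))
  refine not_integrable_of_const_le h.integrable (pow_pos (h.pos a) 2) (y₀ := a) fun y hy => ?_
  exact pow_le_pow_left₀ (h.pos a).le (hm2 (Set.mem_Ici.2 le_rfl) hy hy) 2

theorem exists_V_nonneg : ∃ a : ℝ, 0 < a ∧ ∀ y, a ≤ y → 0 ≤ V y := by
  obtain ⟨a, ha, hT⟩ := exists_T_eq (t := 2 / 3) (by norm_num) (by norm_num)
  refine ⟨a, ha, fun y hy => V_nonneg ?_⟩
  have := T_strictMono.monotone hy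
  nlinarith

theorem tendsto_zero (h : PosSol μ φ φ') :
    Tendsto φ atTop (nhds 0) ∧ Tendsto φ' atTop (nhds 0) := by
  obtain ⟨a, -, ha⟩ := exists_V_nonneg
  have hV : ∀ y, a ≤ y → 0 ≤ V y + μ ^ 2 := fun y hy => add_nonneg (ha y hy) (sq_nonneg μ)
  have hneg : ∀ y, a ≤ y → φ' y ≤ 0 := fun y hy =>
    h.deriv_nonpos_of_convex fun z hz => hV z (hy.trans hz)
  have hmono := monotoneOn_Ici_of_hasDerivAt h.deriv_two
    (fun y hy => mul_nonneg (hV y hy) (h.pos y).le)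
  have hanti : ∀ x y, a ≤ x → x ≤ y → φ y ≤ φ x := fun x y hx hxy => by
    have := monotoneOn_Ici_of_hasDerivAt (fun y => (h.deriv_one y).fun_neg)
      (fun y hy => neg_nonneg.2 (hneg y hy)) (Set.mem_Ici.2 hx) (Set.mem_Ici.2 (hx.trans hxy)) hxy
    simpa using this
  constructor
  · refine tendsto_order.2 ⟨fun c hc => Eventually.of_forall fun y => hc.trans (h.pos y),
      fun c hc => ?_⟩
    by_contra hcon
    refine not_integrable_of_const_le h.integrable (pow_pos hc 2) (y₀ := a) fun y hy => ?_
    refine pow_le_pow_left₀ hc.le ?_ 2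
    by_contra! hlt
    exact hcon ((eventually_ge_atTop y).mono fun z hz => (hanti y z hy hz).trans_lt hlt)
  · refine tendsto_order.2 ⟨fun c hc => ?_, fun c hc => (eventually_ge_atTop a).mono
      fun y hy => (hneg y hy).trans_lt hc⟩
    by_contra hcon
    have hle : ∀ y, a ≤ y → φ' y ≤ c := fun y hy => by
      by_contra! hlt
      exact hcon ((eventually_ge_atTop y).mono fun z hz =>
        hlt.trans_le (hmono hy (Set.mem_Ici.2 (hy.trans hz)) hz))
    have hd := monotoneOn_Ici_of_hasDerivAt (F := fun y => c * y - φ y) (F' := fun y => c - φ' y)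
      (a := a) (fun y => (((hasDerivAt_id' y).const_mul c).fun_sub (h.deriv_one y)).congr_deriv
        (by ring)) (fun y hy => sub_nonneg.2 (hle y hy))
    -- If `φ'` stayed below `c < 0`, then `φ` would lie under a line of slope `c` through `(a, φ
    -- a)`; this is the point where that line reaches `0`.
    have hz : a ≤ a + φ a / -c := by
      have := div_pos (h.pos a) (neg_pos.2 hc)
      linarith
    have h1 := hd (Set.mem_Ici.2 le_rfl) (Set.mem_Ici.2 hz) hz
    have h2 := h.pos (a + φ a / -c)
    have h3 : c * (φ a / -c) = -φ a := by
      have := hc.ne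
      field_simp
    simp only [mul_add, h3] at h1
    linarith

/-- The Wronskian of `φ` and its reflection is constant and tends to `0`, so their ratio is
constant, equal to its value `1` at the origin. -/
theorem even (h : PosSol μ φ φ') (y : ℝ) : φ (-y) = φ y := by
  have hr := h.reflect
  have hW : ∀ x, HasDerivAt (fun x => φ x * -φ' (-x) - φ' x * φ (-x)) 0 x := fun x =>
    (((h.deriv_one x).fun_mul (hr.deriv_two x)).fun_sub
      ((h.deriv_two x).fun_mul (hr.deriv_one x))).congr_deriv (by ring)
  have hlim : Tendsto (fun x => φ x * -φ' (-x) - φ' x * φ (-x)) atTop (nhds 0) := by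
    have := (h.tendsto_zero.1.mul hr.tendsto_zero.2).sub (h.tendsto_zero.2.mul hr.tendsto_zero.1)
    simpa using this
  have hW0 : ∀ x, φ x * -φ' (-x) - φ' x * φ (-x) = 0 := fun x =>
    le_antisymm
      (nonpos_of_tendsto_zero (F := fun x => φ x * -φ' (-x) - φ' x * φ (-x)) hW
        (fun _ _ => le_rfl) hlim)
      (nonneg_of_tendsto_zero (F := fun x => φ x * -φ' (-x) - φ' x * φ (-x)) hW
        (fun _ _ => le_rfl) hlim)
  have hq : ∀ x, HasDerivAt (fun x => φ (-x) / φ x) 0 x := fun x =>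
    ((hr.deriv_one x).fun_div (h.deriv_one x) (h.pos x).ne').congr_deriv (by
      rw [div_eq_zero_iff]
      left
      linarith [hW0 x])
  have := is_const_of_deriv_eq_zero (fun x => (hq x).differentiableAt) (fun x => (hq x).deriv) y 0
  simp only [neg_zero, div_self (h.pos 0).ne'] at this
  exact (div_eq_one_iff_eq (h.pos y).ne').1 this

theorem deriv_odd (h : PosSol μ φ φ') (y : ℝ) : φ' (-y) = -φ' y := by
  have h1 : HasDerivAt φ (-φ' (-y)) y := by
    have := h.reflect.deriv_one y
    simp only [h.even] at this
    exact this
  have := h1.unique (h.deriv_one y)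
  linarith

theorem deriv_zero (h : PosSol μ φ φ') : φ' 0 = 0 := by
  have := h.deriv_odd 0
  rw [neg_zero] at this
  linarith

/-- On the half-line `V + μ²` changes sign at most once, from negative to positive. Hence either `φ`
is convex from `y` on, or it is concave on `[0, y]`, where `φ'` starts at `0`. -/
theorem deriv_nonpos (h : PosSol μ φ φ') {y : ℝ} (hy : 0 ≤ y) : φ' y ≤ 0 := by
  by_cases hV : 0 ≤ V y + μ ^ 2
  · refine h.deriv_nonpos_of_convex fun z hz => ?_
    rcases le_total (T z ^ 2) (1 / 3) with hs | hs
    · linarith [V_le_V hy hz hs]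
    · linarith [V_nonneg hs, sq_nonneg μ]
  · push Not at hV
    have hs : T y ^ 2 ≤ 1 / 3 := by
      by_contra! hs
      linarith [V_nonneg hs.le, sq_nonneg μ]
    have hm : AntitoneOn φ' (Set.Icc 0 y) := by
      refine antitoneOn_of_deriv_nonpos (convex_Icc 0 y)
        (fun y _ => (h.deriv_two y).continuousAt.continuousWithinAt)
        (fun y _ => (h.deriv_two y).differentiableAt.differentiableWithinAt) fun z hz => ?_
      rw [(h.deriv_two z).deriv]
      rw [interior_Icc] at hz
      have := V_le_V hz.1.le hz.2.le hs
      exact mul_nonpos_of_nonpos_of_nonneg (by linarith) (h.pos z).le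
    exact (hm (Set.left_mem_Icc.2 hy) (Set.right_mem_Icc.2 hy) hy).trans_eq h.deriv_zero

end PosSol

/-! ### The logarithmic derivative of a positive solution -/

/-- Bernstein basis polynomials are nonnegative on their interval. -/
theorem bernstein_nonneg {a b s : ℝ} (ha : a ≤ s) (hb : s ≤ b) (i j : ℕ) :
    0 ≤ (s - a) ^ i * (b - s) ^ j :=
  mul_nonneg (pow_nonneg (sub_nonneg.2 ha) i) (pow_nonneg (sub_nonneg.2 hb) j)

/-- The quintic barrier functions. -/
noncomputable def barrier (k c d y : ℝ) : ℝ := T y * (k + c * T y ^ 2 + d * (T y ^ 2) ^ 2)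

theorem hasDerivAt_barrier (k c d y : ℝ) : HasDerivAt (barrier k c d)
    (3 / 4 * (1 - T y ^ 2) ^ 2 * (k + 3 * c * T y ^ 2 + 5 * d * (T y ^ 2) ^ 2)) y := by
  have hT := hasDerivAt_T y
  have hT2 := hT.fun_pow 2
  refine (hT.fun_mul (((hT2.const_mul c).const_add k).fun_add
    ((hT2.fun_pow 2).const_mul d))).congr_deriv ?_
  push_cast
  ring

theorem continuous_barrier (k c d : ℝ) : Continuous (barrier k c d) :=
  continuous_iff_continuousAt.2 fun y => (hasDerivAt_barrier k c d y).continuousAt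

/-- The residual of a barrier in the Riccati equation, in terms of `s = T ^ 2`. -/
noncomputable def residual (k c d m s : ℝ) : ℝ :=
  3 / 4 * (1 - s) ^ 2 * (k + 3 * c * s + 5 * d * s ^ 2) - s * (k + c * s + d * s ^ 2) ^ 2 +
    9 / 4 * (1 - s) ^ 2 * (3 * s - 1) + m

/-- Minus the logarithmic derivative `-φ' / φ`. -/
noncomputable def sigma (φ φ' : ℝ → ℝ) (y : ℝ) : ℝ := -φ' y / φ y

namespace PosSol

variable {μ : ℝ} {φ φ' : ℝ → ℝ}

theorem hasDerivAt_sigma (h : PosSol μ φ φ') (y : ℝ) :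
    HasDerivAt (sigma φ φ') (sigma φ φ' y ^ 2 - V y - μ ^ 2) y := by
  have hp := (h.pos y).ne'
  refine ((h.deriv_two y).fun_neg.fun_div (h.deriv_one y) hp).congr_deriv ?_
  unfold sigma
  field_simp
  ring

theorem continuous_sigma (h : PosSol μ φ φ') : Continuous (sigma φ φ') :=
  continuous_iff_continuousAt.2 fun y => (h.hasDerivAt_sigma y).continuousAt

theorem deriv_eq (h : PosSol μ φ φ') (y : ℝ) : φ' y = -sigma φ φ' y * φ y := by
  have hp := (h.pos y).ne'
  unfold sigma
  field_simp

theorem sigma_nonneg (h : PosSol μ φ φ') {y : ℝ} (hy : 0 ≤ y) : 0 ≤ sigma φ φ' y :=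
  div_nonneg (neg_nonneg.2 (h.deriv_nonpos hy)) (h.pos y).le

theorem sigma_zero (h : PosSol μ φ φ') : sigma φ φ' 0 = 0 := by
  unfold sigma
  rw [h.deriv_zero, neg_zero, zero_div]

theorem sigma_neg (h : PosSol μ φ φ') (y : ℝ) : sigma φ φ' (-y) = -sigma φ φ' y := by
  unfold sigma
  rw [h.deriv_odd, h.even, neg_div]

/-- The energies `φ'² - (K + θ V) φ²`, used to bound the logarithmic derivative. -/
theorem hasDerivAt_energy (h : PosSol μ φ φ') (K θ y : ℝ) :
    HasDerivAt (fun y => φ' y ^ 2 - (K + θ * V y) * φ y ^ 2)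
      (φ y ^ 2 * (-(2 * sigma φ φ' y * ((1 - θ) * V y + μ ^ 2 - K)) - θ * DV y)) y := by
  refine (((h.deriv_two y).fun_pow 2).fun_sub
    ((((hasDerivAt_V y).const_mul θ).const_add K).fun_mul
      ((h.deriv_one y).fun_pow 2))).congr_deriv ?_
  rw [h.deriv_eq y]
  push_cast
  ring

theorem abs_V_le (y : ℝ) : |V y| ≤ 9 / 4 := by
  have h1 := T_sq_lt_one y
  have h0 := sq_nonneg (T y)
  refine abs_le.2 ⟨?_, by linarith [V_le y]⟩
  rw [V_eq]
  nlinarith [mul_nonneg h0 h0, mul_nonneg (mul_nonneg h0 h0) h0, mul_nonneg h0 (sub_pos.2 h1).le]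

theorem tendsto_energy (h : PosSol μ φ φ') (K θ : ℝ) :
    Tendsto (fun y => φ' y ^ 2 - (K + θ * V y) * φ y ^ 2) atTop (nhds 0) := by
  obtain ⟨h0, h1⟩ := h.tendsto_zero
  have hb : Tendsto (fun y => (K + θ * V y) * φ y ^ 2) atTop (nhds 0) := by
    refine bdd_le_mul_tendsto_zero' (|K| + |θ| * (9 / 4)) (Eventually.of_forall fun y => ?_)
      (by simpa using h0.pow 2)
    refine (abs_add_le _ _).trans ?_
    rw [abs_mul]
    gcongr
    exact abs_V_le y
  simpa using (h1.pow 2).sub hb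

theorem energy_eq (h : PosSol μ φ φ') (K θ y : ℝ) : φ' y ^ 2 - (K + θ * V y) * φ y ^ 2 =
    (sigma φ φ' y ^ 2 - (K + θ * V y)) * φ y ^ 2 := by
  rw [h.deriv_eq y]
  ring

/-- As `8/27` is the maximum of `V`, the energy with `K = 8/27 + μ²`, `θ = 0` increases to `0`. -/
theorem sigma_sq_le (h : PosSol μ φ φ') {y : ℝ} (hy : 0 ≤ y) :
    sigma φ φ' y ^ 2 ≤ 8 / 27 + μ ^ 2 := by
  have := nonpos_of_tendsto_zero (h.hasDerivAt_energy (8 / 27 + μ ^ 2) 0) (a := y) (fun z hz => by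
    refine mul_nonneg (sq_nonneg _) ?_
    have := mul_nonneg (h.sigma_nonneg (hy.trans hz)) (sub_nonneg.2 (V_le z))
    linarith) (h.tendsto_energy _ _)
  rw [h.energy_eq] at this
  have := nonpos_of_mul_nonpos_left this (pow_pos (h.pos y) 2)
  linarith

/-- From `y` on `V ≥ 0`, so the energy with `K = μ²`, `θ = 0` decreases to `0`. -/
theorem mu_le_sigma (h : PosSol μ φ φ') {y : ℝ} (hy : 0 ≤ y) (hs : 1 / 3 ≤ T y ^ 2) :
    μ ≤ sigma φ φ' y := by
  have := nonneg_of_tendsto_zero (h.hasDerivAt_energy (μ ^ 2) 0) (a := y) (fun z hz => by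
    refine mul_nonpos_of_nonneg_of_nonpos (sq_nonneg _) ?_
    have hT := pow_le_pow_left₀ (T_nonneg hy) (T_strictMono.monotone hz) 2
    have := mul_nonneg (h.sigma_nonneg (hy.trans hz)) (V_nonneg (hs.trans hT))
    linarith) (h.tendsto_energy _ _)
  rw [h.energy_eq] at this
  have := nonneg_of_mul_nonneg_left this (pow_pos (h.pos y) 2)
  exact (abs_le_of_sq_le_sq' (by linarith) (h.sigma_nonneg hy)).2

/-- A nonpositive residual makes the barrier `B` a Riccati subsolution; `u = σ - B` vanishes at `0`
and satisfies `u' ≥ (σ + B) u`. -/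
theorem barrier_le_sigma (h : PosSol μ φ φ') {k c d y : ℝ} (hy : 0 ≤ y)
    (hres : ∀ s, 0 ≤ s → s ≤ T y ^ 2 → residual k c d (μ ^ 2) s ≤ 0) :
    barrier k c d y ≤ sigma φ φ' y := by
  refine sub_nonneg.1 (nonneg_of_deriv_ge_mul (u := fun y => sigma φ φ' y - barrier k c d y)
    (h.continuous_sigma.add (continuous_barrier k c d))
    (fun z => (h.hasDerivAt_sigma z).fun_sub (hasDerivAt_barrier k c d z)) ?_ ?_ hy)
  · rw [h.sigma_zero, barrier, T_zero]
    simp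
  · intro z hz hzy
    have hT := pow_le_pow_left₀ (T_nonneg hz) (T_strictMono.monotone hzy) 2
    have := hres _ (sq_nonneg (T z)) hT
    rw [residual] at this
    rw [Pi.add_apply, V_eq, barrier]
    linarith

theorem sigma_le_barrier (h : PosSol μ φ φ') {k c d y : ℝ} (hy : 0 ≤ y)
    (hres : ∀ s, 0 ≤ s → s ≤ T y ^ 2 → 0 ≤ residual k c d (μ ^ 2) s) :
    sigma φ φ' y ≤ barrier k c d y := by
  refine sub_nonneg.1 (nonneg_of_deriv_ge_mul (u := fun y => barrier k c d y - sigma φ φ' y)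
    (h.continuous_sigma.add (continuous_barrier k c d))
    (fun z => (hasDerivAt_barrier k c d z).fun_sub (h.hasDerivAt_sigma z)) ?_ ?_ hy)
  · rw [h.sigma_zero, barrier, T_zero]
    simp
  · intro z hz hzy
    have hT := pow_le_pow_left₀ (T_nonneg hz) (T_strictMono.monotone hzy) 2
    have := hres _ (sq_nonneg (T z)) hT
    rw [residual] at this
    rw [Pi.add_apply, V_eq, barrier]
    linarith

/-! ### Bounds for the first eigenvalue -/

/-- At `s = 0` the residual is `(3/4)(k - (3 - 4m/3))`, so `k` is taken just below `3 - 4m/3` for a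
subsolution, and just above it for the supersolutions. Each subinterval gets its own Bernstein
expansion. -/
theorem residual_lower {s : ℝ} (h0 : 0 ≤ s) (h1 : s ≤ 49 / 100) :
    residual (107 / 50) (-8 / 5) (2 / 5) (16 / 25) s ≤ 0 := by
  rw [residual]
  rcases le_total s (1 / 4) with h | h
  · have hb := bernstein_nonneg h0 h
    linarith [hb 0 5, hb 1 4, hb 2 3, hb 3 2, hb 4 1, hb 5 0]
  · have hb := bernstein_nonneg h h1
    linarith [hb 0 5, hb 1 4, hb 2 3, hb 3 2, hb 4 1, hb 5 0]

theorem residual_upper {s : ℝ} (h0 : 0 ≤ s) (h1 : s ≤ 9 / 16) :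
    0 ≤ residual (52 / 25) (-31 / 20) (-3 / 5) (7 / 10) s := by
  rw [residual]
  rcases le_total s (7 / 25) with h | h
  · have hb := bernstein_nonneg h0 h
    linarith [hb 0 5, hb 1 4, hb 2 3, hb 3 2, hb 4 1, hb 5 0]
  · have hb := bernstein_nonneg h h1
    linarith [hb 0 5, hb 1 4, hb 2 3, hb 3 2, hb 4 1, hb 5 0]

/-- A smaller `μ²` would keep the barrier a subsolution and force `σ > 1` at `T = 7/10`, exceeding
the bound `σ² ≤ 8/27 + μ²`. -/
theorem le_mu_sq (h : PosSol μ φ φ') : 16 / 25 ≤ μ ^ 2 := by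
  by_contra! hlt
  obtain ⟨y, hy, hT⟩ := exists_T_eq (t := 7 / 10) (by norm_num) (by norm_num)
  have h1 := h.barrier_le_sigma (k := 107 / 50) (c := -8 / 5) (d := 2 / 5) hy.le
    fun s h0 hs => by
      rw [hT] at hs
      have := residual_lower h0 (by linarith)
      rw [residual] at this ⊢
      linarith
  rw [barrier, hT] at h1
  have h2 := h.sigma_sq_le hy.le
  nlinarith

/-- A larger `μ²` would keep the barrier a supersolution and push `σ` below `μ` at `T = 3/4`, where
`V ≥ 0` forces `σ ≥ μ`. -/
theorem mu_sq_le (h : PosSol μ φ φ') : μ ^ 2 ≤ 7 / 10 := by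
  by_contra! hlt
  obtain ⟨y, hy, hT⟩ := exists_T_eq (t := 3 / 4) (by norm_num) (by norm_num)
  have h1 := h.sigma_le_barrier (k := 52 / 25) (c := -31 / 20) (d := -3 / 5) hy.le
    fun s h0 hs => by
      rw [hT] at hs
      have := residual_upper h0 (by linarith)
      rw [residual] at this ⊢
      linarith
  rw [barrier, hT] at h1
  have h2 := h.mu_le_sigma hy.le (by rw [hT]; norm_num)
  nlinarith [h.mu_pos]

theorem le_mu (h : PosSol μ φ φ') : 4 / 5 ≤ μ :=
  (abs_le_of_sq_le_sq' (by linarith [h.le_mu_sq]) h.mu_pos.le).2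

theorem sigma_le_one (h : PosSol μ φ φ') {y : ℝ} (hy : 0 ≤ y) : sigma φ φ' y ≤ 1 := by
  have := h.sigma_sq_le hy
  have := h.mu_sq_le
  exact (abs_le_of_sq_le_sq' (by linarith) zero_le_one).2

/-- Beyond the maximum of `V` the energy with `K = μ²`, `θ = 3/4` decreases to `0`: the term `σ V /
2` outweighs `(3/4) |V'|`. -/
theorem le_sigma_sq (h : PosSol μ φ φ') {y : ℝ} (hy : 0 ≤ y) (hs : 5 / 9 ≤ T y ^ 2) :
    μ ^ 2 + 3 / 4 * V y ≤ sigma φ φ' y ^ 2 := by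
  have := nonneg_of_tendsto_zero (h.hasDerivAt_energy (μ ^ 2) (3 / 4)) (a := y) (fun z hz => by
    refine mul_nonpos_of_nonneg_of_nonpos (sq_nonneg _) ?_
    have hs := hs.trans (pow_le_pow_left₀ (T_nonneg hy) (T_strictMono.monotone hz) 2)
    have hV := mul_le_mul_of_nonneg_right
      (h.le_mu.trans (h.mu_le_sigma (hy.trans hz) (by linarith))) (V_nonneg (y := z) (by linarith))
    have h1 := T_sq_lt_one z
    -- Removes the odd factor `T` from `V'`, leaving a polynomial in `s = T²`.
    have hT : 2 * T z ≤ 1 + T z ^ 2 := by nlinarith [sq_nonneg (T z - 1)]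
    have hpoly : 0 ≤ 9 / 10 * (3 * T z ^ 2 - 1) -
        81 / 64 * ((1 + T z ^ 2) * (1 - T z ^ 2)) * (9 * T z ^ 2 - 5) := by
      generalize T z ^ 2 = s at *
      rcases le_total s (3 / 4) with h | h
      · have hb := bernstein_nonneg hs h
        linarith [hb 0 3, hb 1 2, hb 2 1, hb 3 0]
      · have hb := bernstein_nonneg h h1.le
        linarith [hb 0 3, hb 1 2, hb 2 1, hb 3 0]
    have h2 : 0 ≤ (1 - T z ^ 2) ^ 3 * (9 * T z ^ 2 - 5) :=
      mul_nonneg (pow_nonneg (by linarith) 3) (by linarith)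
    have h3 := mul_le_mul_of_nonneg_right hT h2
    have h4 := mul_nonneg (sq_nonneg (1 - T z ^ 2)) hpoly
    rw [V_eq] at hV ⊢
    unfold DV
    linarith) (h.tendsto_energy _ _)
  rw [h.energy_eq] at this
  have := nonneg_of_mul_nonneg_left this (pow_pos (h.pos y) 2)
  linarith

end PosSol

namespace PosSol

variable {μ : ℝ} {φ φ' : ℝ → ℝ}

/-! ### The derivative of the transformed potential -/

/-- The weighted difference `(w w' - c V') φ²`, where `w = φ' / φ`. -/
theorem hasDerivAt_flux (h : PosSol μ φ φ') (c y : ℝ) :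
    HasDerivAt (fun y => (-(sigma φ φ' y * (V y + μ ^ 2 - sigma φ φ' y ^ 2)) - c * DV y) * φ y ^ 2)
      (φ y ^ 2 * ((V y + μ ^ 2 - sigma φ φ' y ^ 2) ^ 2 - (1 - 2 * c) * (sigma φ φ' y * DV y) -
        c * DDV y)) y := by
  have hs := h.hasDerivAt_sigma y
  refine (((hs.fun_mul (((hasDerivAt_V y).add_const (μ ^ 2)).fun_sub
    (hs.fun_pow 2))).fun_neg.fun_sub ((hasDerivAt_DV y).const_mul c)).fun_mul
      ((h.deriv_one y).fun_pow 2)).congr_deriv ?_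
  rw [h.deriv_eq y]
  push_cast
  ring

theorem tendsto_flux (h : PosSol μ φ φ') (c : ℝ) :
    Tendsto (fun y => (-(sigma φ φ' y * (V y + μ ^ 2 - sigma φ φ' y ^ 2)) - c * DV y) * φ y ^ 2)
      atTop (nhds 0) := by
  refine bdd_le_mul_tendsto_zero' (1 * 4 + |c| * 30) ?_ (by simpa using h.tendsto_zero.1.pow 2)
  filter_upwards [eventually_ge_atTop 0] with y hy
  have h0 := h.sigma_nonneg hy
  have h1 := h.sigma_le_one hy
  have h2 : |V y + μ ^ 2 - sigma φ φ' y ^ 2| ≤ 4 := by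
    have := abs_le.1 (abs_V_le y)
    have := h.mu_sq_le
    have := pow_le_one₀ h0 h1 (n := 2)
    exact abs_le.2 ⟨by linarith [sq_nonneg μ], by linarith [sq_nonneg (sigma φ φ' y)]⟩
  refine (abs_sub _ _).trans ?_
  rw [abs_neg, abs_mul, abs_mul, abs_of_nonneg h0]
  gcongr
  exact abs_DV_le y

theorem hasDerivAt_V0 (h : PosSol μ φ φ') (hφ : φ' = deriv φ) (y : ℝ) :
    HasDerivAt (V0 μ φ) (-4 * (sigma φ φ' y * (V y + μ ^ 2 - sigma φ φ' y ^ 2)) - DV y) y := by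
  have e : V0 μ φ = fun y => 2 * sigma φ φ' y ^ 2 - 2 * μ ^ 2 - V y := by
    funext y
    unfold V0 sigma
    rw [hφ]
    ring
  rw [e]
  refine (((((h.hasDerivAt_sigma y).fun_pow 2).const_mul 2).sub_const _).fun_sub
    (hasDerivAt_V y)).congr_deriv ?_
  push_cast
  ring

/-! #### Negativity -/

theorem residual_near_zero {s : ℝ} (h0 : 0 ≤ s) (h1 : s ≤ 1 / 4) :
    0 ≤ residual (54 / 25) (-31 / 20) (3 / 5) (16 / 25) s := by
  rw [residual]
  have hb := bernstein_nonneg h0 h1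
  linarith [hb 0 5, hb 1 4, hb 2 3, hb 3 2, hb 4 1, hb 5 0]

/-- Here `V' > 0`, so only `w' < 0` needs work. Then `σ (σ² - V - μ²)` grows with `σ` and shrinks
with `μ²`, so a supersolution replaces `σ` and `16/25` replaces `μ²`. -/
theorem flux_neg_near_zero (h : PosSol μ φ φ') {y : ℝ} (hy : 0 < y) (hs : T y ^ 2 ≤ 1 / 4) :
    -(sigma φ φ' y * (V y + μ ^ 2 - sigma φ φ' y ^ 2)) < 1 / 4 * DV y := by
  have hT := T_pos hy
  have h0 := h.sigma_nonneg hy.le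
  have hDV : 0 < DV y := by
    unfold DV
    have h1 : 0 < 1 - T y ^ 2 := by linarith
    have h2 : 0 < 5 - 9 * T y ^ 2 := by linarith
    positivity
  rcases le_total 0 (V y + μ ^ 2 - sigma φ φ' y ^ 2) with hp | hp
  · have := mul_nonneg h0 hp
    linarith
  have hb := h.sigma_le_barrier (k := 54 / 25) (c := -31 / 20) (d := 3 / 5) hy.le
    fun s hs0 hs1 => by
      have := residual_near_zero hs0 (hs1.trans hs)
      have := h.le_mu_sq
      rw [residual] at *
      linarith
  have hm := h.le_mu_sq
  have h1 : sigma φ φ' y * (sigma φ φ' y ^ 2 - V y - μ ^ 2) ≤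
      barrier (54 / 25) (-31 / 20) (3 / 5) y *
        (barrier (54 / 25) (-31 / 20) (3 / 5) y ^ 2 - V y - 16 / 25) := by
    have := pow_le_pow_left₀ h0 hb 2
    exact mul_le_mul hb (by linarith) (by linarith) (h0.trans hb)
  have h2 : barrier (54 / 25) (-31 / 20) (3 / 5) y *
        (barrier (54 / 25) (-31 / 20) (3 / 5) y ^ 2 - V y - 16 / 25) < 1 / 4 * DV y := by
    rw [V_eq, barrier, DV]
    generalize T y = t at *
    -- The required inequality divided by the common factor `t > 0`.
    have key : 0 < 27 / 32 * (1 - t ^ 2) ^ 3 * (5 - 9 * t ^ 2) -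
        (54 / 25 + -31 / 20 * t ^ 2 + 3 / 5 * (t ^ 2) ^ 2) *
          (t ^ 2 * (54 / 25 + -31 / 20 * t ^ 2 + 3 / 5 * (t ^ 2) ^ 2) ^ 2 -
            9 / 4 * (1 - t ^ 2) ^ 2 * (3 * t ^ 2 - 1) - 16 / 25) := by
      have hb := bernstein_nonneg (sq_nonneg t) hs
      generalize t ^ 2 = s at *
      linarith [hb 0 7, hb 1 6, hb 2 5, hb 3 4, hb 4 3, hb 5 2, hb 6 1, hb 7 0]
    have := mul_pos hT key
    linarith
  linarith

/-- This is the derivative factor for `c = 1/4` without the square `(w')²`. Up to the maximum of `V`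
the term in `V' ≥ 0` is controlled by `σ ≤ 1`; beyond it `V' ≤ 0` helps, through `σ ≥ 4/5`. -/
theorem flux_deriv_pos (h : PosSol μ φ φ') {y : ℝ} (hy : 0 ≤ y) (hs : 1 / 4 ≤ T y ^ 2) :
    0 < -(1 / 2 * (sigma φ φ' y * DV y)) - 1 / 4 * DDV y := by
  have hT := T_nonneg hy
  have h1 := T_sq_lt_one y
  have hd : 0 < 1 - T y ^ 2 := by linarith
  rcases le_total (T y ^ 2) (5 / 9) with h59 | h59
  · have hDV : 0 ≤ DV y := by
      unfold DV
      have h2 : 0 ≤ 5 - 9 * T y ^ 2 := by linarith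
      positivity
    have h3 := mul_le_mul_of_nonneg_right (h.sigma_le_one hy) hDV
    -- The odd power of `T` remains in this case, so the expansion is in `t = T` on `[1/2, 3/4]`,
    -- which contains the range `1/4 ≤ t² ≤ 5/9`.
    have h4 : 1 / 2 ≤ T y := by nlinarith
    have h5 : T y ≤ 3 / 4 := by nlinarith
    have key : 0 < -3 * (1 - T y ^ 2) * (81 * (T y ^ 2) ^ 2 - 62 * T y ^ 2 + 5) -
        8 * T y * (5 - 9 * T y ^ 2) := by
      generalize T y = t at *
      have hb := bernstein_nonneg h4 h5
      linarith [hb 0 6, hb 1 5, hb 2 4, hb 3 3, hb 4 2, hb 5 1, hb 6 0]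
    have := mul_pos (pow_pos hd 3) key
    unfold DDV
    unfold DV at h3 ⊢
    linarith
  · have hT1 : T y ^ 2 ≤ T y := by nlinarith [T_lt_one y]
    have h2 : 0 ≤ (1 - T y ^ 2) ^ 3 * (9 * T y ^ 2 - 5) :=
      mul_nonneg (pow_nonneg hd.le 3) (by linarith)
    have h3 : 4 / 5 * T y ^ 2 ≤ sigma φ φ' y * T y :=
      mul_le_mul (h.le_mu.trans (h.mu_le_sigma hy (by linarith))) hT1 (sq_nonneg _)
        (h.sigma_nonneg hy)
    have h4 := mul_le_mul_of_nonneg_right h3 h2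
    have key : 0 < 32 / 5 * T y ^ 2 * (9 * T y ^ 2 - 5) -
        3 * (1 - T y ^ 2) * (81 * (T y ^ 2) ^ 2 - 62 * T y ^ 2 + 5) := by
      generalize T y ^ 2 = s at *
      have hb := bernstein_nonneg h59 h1.le
      linarith [hb 0 3, hb 1 2, hb 2 1, hb 3 0]
    have := mul_pos (pow_pos hd 3) key
    unfold DDV DV
    linarith

theorem T_sq_le_T_sq {y z : ℝ} (hy : 0 ≤ y) (hz : y ≤ z) : T y ^ 2 ≤ T z ^ 2 :=
  pow_le_pow_left₀ (T_nonneg hy) (T_strictMono.monotone hz) 2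

theorem flux_neg (h : PosSol μ φ φ') {y : ℝ} (hy : 0 < y) :
    -(sigma φ φ' y * (V y + μ ^ 2 - sigma φ φ' y ^ 2)) < 1 / 4 * DV y := by
  rcases le_total (T y ^ 2) (1 / 4) with hs | hs
  · exact h.flux_neg_near_zero hy hs
  · have := neg_of_tendsto_zero (h.hasDerivAt_flux (1 / 4)) (a := y) (fun z hz => by
      have := h.flux_deriv_pos (hy.le.trans hz) (hs.trans (T_sq_le_T_sq hy.le hz))
      refine mul_pos (pow_pos (h.pos z) 2) ?_
      linarith [sq_nonneg (V z + μ ^ 2 - sigma φ φ' z ^ 2)]) (h.tendsto_flux _)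
    have := neg_of_mul_neg_left this (sq_nonneg _)
    linarith

/-! #### The tail, where `V` is convex -/

/-- The derivative factor for `c = 3/8` without `(w')²`. The claim compares `σ T` with a function of
`T²`; squaring makes it polynomial in `T²` after `le_sigma_sq` bounds `σ²` below. -/
theorem flux_upper_deriv (h : PosSol μ φ φ') {y : ℝ} (hy : 0 ≤ y) (hs : 67 / 100 ≤ T y ^ 2) :
    0 ≤ -(1 / 4 * (sigma φ φ' y * DV y)) - 3 / 8 * DDV y := by
  have hT := T_nonneg hy
  have h1 := T_sq_lt_one y
  have hd : 0 < 1 - T y ^ 2 := by linarith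
  have h0 := h.sigma_nonneg hy
  have h2 : 16 / 25 + 27 / 16 * ((1 - T y ^ 2) ^ 2 * (3 * T y ^ 2 - 1)) ≤ sigma φ φ' y ^ 2 := by
    have := h.le_sigma_sq hy (by linarith)
    rw [V_eq] at this
    linarith [h.le_mu_sq]
  have h3 : 0 ≤ T y ^ 2 * (9 * T y ^ 2 - 5) ^ 2 := by positivity
  have h4 := mul_le_mul_of_nonneg_right h2 h3
  have key : 0 ≤ (16 / 25 + 27 / 16 * ((1 - T y ^ 2) ^ 2 * (3 * T y ^ 2 - 1))) *
      (T y ^ 2 * (9 * T y ^ 2 - 5) ^ 2) -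
      81 / 64 * ((1 - T y ^ 2) ^ 2 * (81 * (T y ^ 2) ^ 2 - 62 * T y ^ 2 + 5) ^ 2) := by
    clear h3 h4 h2
    generalize T y ^ 2 = s at *
    rcases le_total s (76 / 100) with h | h
    · have hb := bernstein_nonneg hs h
      linarith [hb 0 6, hb 1 5, hb 2 4, hb 3 3, hb 4 2, hb 5 1, hb 6 0]
    rcases le_total s (84 / 100) with h' | h'
    · have hb := bernstein_nonneg h h'
      linarith [hb 0 6, hb 1 5, hb 2 4, hb 3 3, hb 4 2, hb 5 1, hb 6 0]
    · have hb := bernstein_nonneg h' h1.le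
      linarith [hb 0 6, hb 1 5, hb 2 4, hb 3 3, hb 4 2, hb 5 1, hb 6 0]
  have h5 : 9 / 8 * ((1 - T y ^ 2) * (81 * (T y ^ 2) ^ 2 - 62 * T y ^ 2 + 5)) ≤
      sigma φ φ' y * (T y * (9 * T y ^ 2 - 5)) := by
    have hq : 0 ≤ 9 * T y ^ 2 - 5 := by linarith
    refine (abs_le_of_sq_le_sq' ?_ (by positivity)).2
    linarith
  have := mul_le_mul_of_nonneg_left h5 (pow_nonneg hd.le 3)
  unfold DDV DV
  linarith

/-- For `c = 1` the square has the wrong sign and must be bounded: `flux_neg` and `V' ≤ 0` give `w'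
≥ 0`, while `le_sigma_sq` gives `w' ≤ V / 4`. Then `V² / 16 + σ V' ≤ 0`, and `V'' ≥ 0` finishes. -/
theorem flux_lower_deriv (h : PosSol μ φ φ') {y : ℝ} (hy : 0 < y) (hs : 67 / 100 ≤ T y ^ 2)
    (hP : 0 ≤ 81 * (T y ^ 2) ^ 2 - 62 * T y ^ 2 + 5) :
    (V y + μ ^ 2 - sigma φ φ' y ^ 2) ^ 2 + sigma φ φ' y * DV y - DDV y ≤ 0 := by
  have hT := T_nonneg hy.le
  have h1 := T_sq_lt_one y
  have hd : 0 < 1 - T y ^ 2 := by linarith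
  have h0 := h.mu_pos.trans_le (h.mu_le_sigma hy.le (by linarith))
  have hq : 0 ≤ (1 - T y ^ 2) ^ 3 * (9 * T y ^ 2 - 5) :=
    mul_nonneg (pow_nonneg hd.le 3) (by linarith)
  have hDDV : 0 ≤ DDV y := mul_nonneg (by positivity) hP
  have hp0 : 0 ≤ V y + μ ^ 2 - sigma φ φ' y ^ 2 := by
    have h2 := h.flux_neg hy
    have h3 : DV y ≤ 0 := by
      have := mul_nonneg hT hq
      unfold DV
      linarith
    exact nonneg_of_mul_nonneg_right (by linarith) h0
  have hp1 : V y + μ ^ 2 - sigma φ φ' y ^ 2 ≤ 1 / 4 * V y := by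
    linarith [h.le_sigma_sq hy.le (by linarith)]
  have hp2 := pow_le_pow_left₀ hp0 hp1 2
  have hT1 : T y ^ 2 ≤ T y := by nlinarith [T_lt_one y]
  have h3 : 4 / 5 * T y ^ 2 ≤ sigma φ φ' y * T y :=
    mul_le_mul (h.le_mu.trans (h.mu_le_sigma hy.le (by linarith))) hT1 (sq_nonneg _) h0.le
  have h4 := mul_le_mul_of_nonneg_right h3 hq
  have key : 0 ≤ 27 / 10 * T y ^ 2 * (9 * T y ^ 2 - 5) -
      81 / 256 * (1 - T y ^ 2) * (3 * T y ^ 2 - 1) ^ 2 := by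
    clear hP h4 hp2
    generalize T y ^ 2 = s at *
    have hb := bernstein_nonneg hs h1.le
    linarith [hb 0 3, hb 1 2, hb 2 1, hb 3 0]
  have := mul_nonneg (pow_nonneg hd.le 3) key
  have h5 : (1 / 4 * V y) ^ 2 + sigma φ φ' y * DV y ≤ 0 := by
    rw [V_eq]
    unfold DV
    linarith
  linarith

theorem tail_bounds (h : PosSol μ φ φ') {a y : ℝ} (ha : 0 < a) (hs : 67 / 100 ≤ T a ^ 2)
    (hP : ∀ z, a ≤ z → 0 ≤ 81 * (T z ^ 2) ^ 2 - 62 * T z ^ 2 + 5) (hy : a ≤ y) :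
    DV y ≤ -(sigma φ φ' y * (V y + μ ^ 2 - sigma φ φ' y ^ 2)) ∧
      -(sigma φ φ' y * (V y + μ ^ 2 - sigma φ φ' y ^ 2)) ≤ 3 / 8 * DV y := by
  have hsz : ∀ z, y ≤ z → 67 / 100 ≤ T z ^ 2 := fun z hz =>
    hs.trans (T_sq_le_T_sq ha.le (hy.trans hz))
  constructor
  · have := nonneg_of_tendsto_zero (h.hasDerivAt_flux 1) (a := y) (fun z hz => by
      have := h.flux_lower_deriv (ha.trans_le (hy.trans hz)) (hsz z hz) (hP z (hy.trans hz))
      refine mul_nonpos_of_nonneg_of_nonpos (sq_nonneg _) ?_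
      linarith) (h.tendsto_flux _)
    have := nonneg_of_mul_nonneg_left this (pow_pos (h.pos y) 2)
    linarith
  · have := nonpos_of_tendsto_zero (h.hasDerivAt_flux (3 / 8)) (a := y) (fun z hz => by
      have := h.flux_upper_deriv (ha.le.trans (hy.trans hz)) (hsz z hz)
      refine mul_nonneg (sq_nonneg _) ?_
      linarith [sq_nonneg (V z + μ ^ 2 - sigma φ φ' z ^ 2)]) (h.tendsto_flux _)
    have := nonpos_of_mul_nonpos_left this (pow_pos (h.pos y) 2)
    linarith

end PosSol

/-! ### The zeros of `V''` -/

theorem exists_DDV_zeros : ∃ x₁ x₂ : ℝ, 0 < x₁ ∧ x₁ < x₂ ∧ {x : ℝ | 0 < x ∧ DDV x = 0} = {x₁, x₂} ∧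
    67 / 100 ≤ T x₂ ^ 2 ∧ ∀ z, x₂ ≤ z → 0 ≤ 81 * (T z ^ 2) ^ 2 - 62 * T z ^ 2 + 5 := by
  have hr := Real.sq_sqrt (show (0 : ℝ) ≤ 556 by norm_num)
  set r := √(556 : ℝ)
  -- Sharp enough to place the larger root `(31 + r) / 81` above `67/100`, where the tail estimates
  -- begin.
  have hr1 : (2357 : ℝ) / 100 < r := Real.lt_sqrt_of_sq_lt (by norm_num)
  have hr2 : r < 24 := (Real.sqrt_lt' (by norm_num)).2 (by norm_num)
  have hP : ∀ s : ℝ, 81 * s ^ 2 - 62 * s + 5 =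
      81 * ((s - (31 - r) / 81) * (s - (31 + r) / 81)) := fun s => by linarith
  have exT : ∀ s : ℝ, 0 < s → s < 1 → ∃ x, 0 < x ∧ T x ^ 2 = s := fun s h0 h1 => by
    obtain ⟨x, hx, hT⟩ := exists_T_eq (Real.sqrt_pos.2 h0)
      ((Real.sqrt_lt' one_pos).2 (by linarith))
    exact ⟨x, hx, by rw [hT, Real.sq_sqrt h0.le]⟩
  obtain ⟨x₁, h1, hT1⟩ := exT ((31 - r) / 81) (by linarith) (by linarith)
  obtain ⟨x₂, h2, hT2⟩ := exT ((31 + r) / 81) (by linarith) (by linarith)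
  have inj : ∀ x y, 0 < x → 0 < y → T x ^ 2 = T y ^ 2 → x = y := fun x y hx hy hxy =>
    T_strictMono.injective ((pow_left_inj₀ (T_pos hx).le (T_pos hy).le two_ne_zero).1 hxy)
  have h12 : x₁ < x₂ := by
    by_contra! hle
    linarith [PosSol.T_sq_le_T_sq h2.le hle]
  refine ⟨x₁, x₂, h1, h12, ?_, by linarith, fun z hz => ?_⟩
  · ext x
    have hd := sub_pos.2 (T_sq_lt_one x)
    have hiff : DDV x = 0 ↔ T x ^ 2 = T x₁ ^ 2 ∨ T x ^ 2 = T x₂ ^ 2 := by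
      unfold DDV
      rw [hP, ← hT1, ← hT2]
      simp only [mul_eq_zero, sub_eq_zero, pow_eq_zero_iff (four_ne_zero)]
      have := hd.ne'
      norm_num
      intro h
      linarith
    constructor
    · rintro ⟨hx, h0⟩
      rcases hiff.1 h0 with h | h
      · exact Or.inl (inj _ _ hx h1 h)
      · exact Or.inr (inj _ _ hx h2 h)
    · rintro (rfl | rfl)
      · exact ⟨h1, hiff.2 (Or.inl rfl)⟩
      · exact ⟨h2, hiff.2 (Or.inr rfl)⟩
  · rw [hP, ← hT1, ← hT2]
    have ha := PosSol.T_sq_le_T_sq h2.le hz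
    have hb := PosSol.T_sq_le_T_sq h1.le (h12.le.trans hz)
    have := mul_nonneg (sub_nonneg.2 hb) (sub_nonneg.2 ha)
    linarith

end BizonKahl

/-! ### Assembly of the theorem -/

open BizonKahl
theorem mainTheorem4 (μ₀ : ℝ) (φ₀ : ℝ → ℝ) (hφ₀ : IsGroundState V μ₀ φ₀) :
    Differentiable ℝ (V0 μ₀ φ₀) ∧
    Function.Odd (deriv (V0 μ₀ φ₀)) ∧
    (∀ x : ℝ, 0 < x → deriv (V0 μ₀ φ₀) x < 0) ∧
    IsRepulsive (V0 μ₀ φ₀) ∧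
    (deriv (V0 μ₀ φ₀) =Θ[cocompact ℝ] deriv V) ∧
    ∃ x₂₁ x₂₂ : ℝ, 0 < x₂₁ ∧ x₂₁ < x₂₂ ∧
      {x : ℝ | 0 < x ∧ deriv (deriv V) x = 0} = {x₂₁, x₂₂} ∧
      ∀ x : ℝ, x₂₂ ≤ x →
        3 * deriv V x ≤ deriv (V0 μ₀ φ₀) x ∧
        deriv (V0 μ₀ φ₀) x ≤ 1 / 2 * deriv V x := by
  have h := hφ₀.posSol
  have hd := h.hasDerivAt_V0 rfl
  have hdiff : Differentiable ℝ (V0 μ₀ φ₀) := fun y => (hd y).differentiableAt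
  have hodd : Function.Odd (deriv (V0 μ₀ φ₀)) := fun y => by
    rw [(hd y).deriv, (hd (-y)).deriv, h.sigma_neg, V_neg, DV_neg]
    ring
  have hneg : ∀ x : ℝ, 0 < x → deriv (V0 μ₀ φ₀) x < 0 := fun x hx => by
    rw [(hd x).deriv]
    linarith [h.flux_neg hx]
  obtain ⟨x₁, x₂, h1, h12, hset, hs, hP⟩ := exists_DDV_zeros
  have htail : ∀ x : ℝ, x₂ ≤ x → 3 * deriv V x ≤ deriv (V0 μ₀ φ₀) x ∧
      deriv (V0 μ₀ φ₀) x ≤ 1 / 2 * deriv V x := fun x hx => by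
    have := h.tail_bounds (h1.trans h12) hs hP hx
    rw [deriv_V, (hd x).deriv]
    constructor <;> linarith
  -- Both derivatives are odd, so the tail bounds on the right give two-sided bounds for large
  -- `|x|`.
  have habs : ∀ x : ℝ, x₂ ≤ |x| → ‖deriv (V0 μ₀ φ₀) x‖ ≤ 3 * ‖deriv V x‖ ∧
      ‖deriv V x‖ ≤ 2 * ‖deriv (V0 μ₀ φ₀) x‖ := fun x hx => by
    have e1 : ‖deriv (V0 μ₀ φ₀) x‖ = ‖deriv (V0 μ₀ φ₀) |x|‖ := by
      rcases abs_choice x with e | e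
      · rw [e]
      · rw [e, hodd x, norm_neg]
    have e2 : ‖deriv V x‖ = ‖deriv V |x|‖ := by
      rcases abs_choice x with e | e
      · rw [e]
      · rw [e, deriv_V, DV_neg, norm_neg]
    obtain ⟨ha, hb⟩ := htail |x| hx
    have hn := hneg |x| ((h1.trans h12).trans_le hx)
    rw [e1, e2, Real.norm_of_nonpos hn.le, Real.norm_of_nonpos (by linarith)]
    constructor <;> linarith
  have hev : ∀ᶠ x : ℝ in cocompact ℝ, x₂ ≤ |x| :=
    (tendsto_norm_cocompact_atTop (E := ℝ)).eventually_ge_atTop x₂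
  refine ⟨hdiff, hodd, hneg, ⟨hdiff, fun x => ?_⟩,
    ⟨IsBigO.of_bound 3 (hev.mono fun x hx => (habs x hx).1),
      IsBigO.of_bound 2 (hev.mono fun x hx => (habs x hx).2)⟩,
    x₁, x₂, h1, h12, by rwa [deriv_V, deriv_DV], htail⟩
  rcases lt_trichotomy x 0 with hx | rfl | hx
  · have := hneg (-x) (neg_pos.2 hx)
    rw [hodd x] at this
    exact mul_nonpos_of_nonpos_of_nonneg hx.le (by linarith)
  · simp
  · exact mul_nonpos_of_nonneg_of_nonpos hx.le (hneg x hx).le
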